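/- For a Hausdorff uniform space $X$, let $U_b(X)$ be the space of bounded uniformly continuous functions $f:X\to\mathbb R$ with the sup norm, let $M(X)$ be its norm dual, and let $M^+(X)=\{\mu\in M(X) : \mu(f)\ge 0 \text{ for all } f\in U_b(X),\ f\ge 0\}$, with the weak* topology of the duality $\langle M(X),U_b(X)\rangle$. For a uniformly continuous pseudometric $d$ on $X$, let $\mathrm{Lip}(d)$ be the set of all $f:X\to\mathbb R$ with $|f(x)|\le 1$ and $|f(x)-f(x')|\le d(x,x')$ for all $x,x'\in X$, with the topology of pointwise convergence. A functional $\mu\in M(X)$ is called a uniform measure if its restriction to $\mathrm{Lip}(d)$ is continuous for every uniformly continuous pseudometric $d$ on $X$. For uniform spaces $X$ and $Y$, the semiuniform product $X*Y$ is the set $X\times Y$ with the uniformity characterized as follows: for every uniform space $W$, a map $p:X*Y\to W$ is uniformly continuous if and only if the family $\{x\mapsto p(x,y) : y\in Y\}$ is uniformly equicontinuous on $X$ and, for each $x\in X$, the map $y\mapsto p(x,y)$ is uniformly continuous on $Y$. The direct product of $\mu\in M(X)$ and $\nu\in M(Y)$ is the functional $\mu\otimes\nu\in M(X*Y)$ given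 by $$(\mu\otimes\nu)(f)=\mu\bigl(x\mapsto\nu(y\mapsto f(x,y))\bigr),\qquad f\in U_b(X*Y).$$ **Theorem.** Let $X$ and $Y$ be Hausdorff uniform spaces, let $\mu_0\in M^+(X)$ be a uniform measure, and let $\nu_0\in M^+(Y)$. When $M^+(X)$, $M^+(Y)$ and $M^+(X*Y)$ are endowed with their weak* topologies, the mapping $(\mu,\nu)\mapsto\mu\otimes\nu$ from $M^+(X)\times M^+(Y)$ to $M^+(X*Y)$ is jointly continuous at $(\mu_0,\nu_0)$. -/

import Mathlib

open Filter Topology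
open scoped Uniformity BoundedContinuousFunction

noncomputable section

namespace UnifMeas

/-! ### The semiuniform product -/

/-- The underlying set of the semiuniform product `X ∗ Y`: pairs `(x, y)`. A separate type is used
because `X × Y` already carries the product uniformity. -/
@[ext]
structure SemiuniformProd (X : Type*) (Y : Type*) where
  /-- first coordinate -/
  fst : X
  /-- second coordinate -/
  snd : Y

/-- The semiuniform product uniformity on `X ∗ Y`: the finest uniformity for which the insertions
`x ↦ (x, y)`, `y ∈ Y`, are uniformly equicontinuous and every insertion `y ↦ (x, y)`, `x ∈ X`, is
uniformly continuous (in Mathlib's order finer uniformities are smaller). It is pinned down by the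
universal property `SemiuniformProd.uniformContinuous_iff` below. -/
instance SemiuniformProd.instUniformSpace {X : Type*} {Y : Type*} [UniformSpace X]
    [UniformSpace Y] : UniformSpace (SemiuniformProd X Y) :=
  sInf {u : UniformSpace (SemiuniformProd X Y) |
    UniformEquicontinuous (uα := u) (fun (y : Y) (x : X) => SemiuniformProd.mk x y) ∧
      ∀ x : X, UniformContinuous[inferInstance, u] (fun y : Y => SemiuniformProd.mk x y)}

theorem SemiuniformProd.uniformEquicontinuous_mk {X : Type*} {Y : Type*} [UniformSpace X]
    [UniformSpace Y] :
    UniformEquicontinuous (fun (y : Y) (x : X) => SemiuniformProd.mk x y) := by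
  unfold SemiuniformProd.instUniformSpace
  rw [sInf_eq_iInf', uniformEquicontinuous_iInf_rng]
  exact fun u => u.2.1

theorem SemiuniformProd.uniformContinuous_mk {X : Type*} {Y : Type*} [UniformSpace X]
    [UniformSpace Y] (x : X) : UniformContinuous (fun y : Y => SemiuniformProd.mk x y) := by
  unfold SemiuniformProd.instUniformSpace
  rw [uniformContinuous_sInf_rng]
  exact fun u hu => hu.2 x

/-- The characteristic property of the semiuniform product: `p : X ∗ Y → W` is uniformly continuous
iff the sections `x ↦ p (x, y)`, `y ∈ Y`, are uniformly equicontinuous and each section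
`y ↦ p (x, y)`, `x ∈ X`, is uniformly continuous. -/
theorem SemiuniformProd.uniformContinuous_iff {X : Type*} {Y : Type*} {W : Type*} [UniformSpace X]
    [UniformSpace Y] [UniformSpace W] {p : SemiuniformProd X Y → W} :
    UniformContinuous p ↔
      UniformEquicontinuous (fun (y : Y) (x : X) => p (SemiuniformProd.mk x y)) ∧
        ∀ x : X, UniformContinuous (fun y : Y => p (SemiuniformProd.mk x y)) := by
  constructor
  · intro hp
    exact ⟨fun U hU => SemiuniformProd.uniformEquicontinuous_mk _ (hp hU),
      fun x => hp.comp (SemiuniformProd.uniformContinuous_mk x)⟩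
  · rintro ⟨h1, h2⟩
    refine uniformContinuous_iff_le_comap.2 (sInf_le ⟨?_, fun x => ?_⟩)
    · rintro U ⟨V, hV, hVU⟩
      filter_upwards [h1 V hV] with z hz y
      exact hVU (hz y)
    · exact uniformContinuous_comap' (h2 x)

/-- The semiuniform product of Hausdorff uniform spaces is Hausdorff. -/
instance SemiuniformProd.instT2Space {X : Type*} {Y : Type*} [UniformSpace X]
    [UniformSpace Y] [T2Space X] [T2Space Y] : T2Space (SemiuniformProd X Y) := by
  have h : UniformContinuous (fun z : SemiuniformProd X Y => (z.fst, z.snd)) := by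
    refine UniformContinuous.prodMk ?_ ?_
    · refine SemiuniformProd.uniformContinuous_iff.2 ⟨?_, fun x => uniformContinuous_const⟩
      intro U hU
      filter_upwards [hU] with z hz y using hz
    · refine SemiuniformProd.uniformContinuous_iff.2 ⟨?_, fun x => uniformContinuous_id⟩
      exact fun U hU => Eventually.of_forall fun z y => refl_mem_uniformity hU
  refine T2Space.of_injective_continuous (fun a b hab => ?_) h.continuous
  exact SemiuniformProd.ext (congrArg Prod.fst hab) (congrArg Prod.snd hab)

/-! ### Functionals on bounded uniformly continuous functions -/

/-- The bounded uniformly continuous real functions on `X`, as a linear subspace of Mathlib's normed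
space of bounded continuous functions. -/
def ubSubmodule (X : Type*) [UniformSpace X] : Submodule ℝ (X →ᵇ ℝ) where
  carrier := {f | UniformContinuous f}
  add_mem' hf hg := UniformContinuous.add hf hg
  zero_mem' := uniformContinuous_const
  smul_mem' c _ hf := UniformContinuous.const_smul hf c

/-- `Ub X`: the space of bounded uniformly continuous real functions on `X`, with the sup norm. -/
def Ub (X : Type*) [UniformSpace X] : Type _ := ↥(ubSubmodule X)

instance Ub.instNormedAddCommGroup {X : Type*} [UniformSpace X] : NormedAddCommGroup (Ub X) :=
  inferInstanceAs (NormedAddCommGroup ↥(ubSubmodule X))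

instance Ub.instNormedSpace {X : Type*} [UniformSpace X] : NormedSpace ℝ (Ub X) :=
  inferInstanceAs (NormedSpace ℝ ↥(ubSubmodule X))

theorem Ub.ext {X : Type*} [UniformSpace X] {f g : Ub X} (h : ∀ x, f.1 x = g.1 x) : f = g :=
  Subtype.ext (BoundedContinuousFunction.ext h)

/-- A bounded uniformly continuous function as an element of `Ub X`. -/
def Ub.mk {X : Type*} [UniformSpace X] (f : X → ℝ) (hf : UniformContinuous f) (C : ℝ)
    (hC : ∀ x, |f x| ≤ C) : Ub X :=
  ⟨BoundedContinuousFunction.ofNormedAddCommGroup f hf.continuous C hC, hf⟩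

/-- `Meas X`: the norm dual of `Ub X` (the norm-continuous linear functionals on `Ub X`), with the
weak* topology of the duality `⟨Meas X, Ub X⟩`. -/
abbrev Meas (X : Type*) [UniformSpace X] : Type _ := WeakDual ℝ (Ub X)

/-- `Meas⁺ X`: the functionals that are nonnegative on nonnegative functions. -/
def MeasPos (X : Type*) [UniformSpace X] : Set (Meas X) :=
  {μ | ∀ f : Ub X, (∀ x, 0 ≤ f.1 x) → 0 ≤ μ f}

/-- `d` is a uniformly continuous pseudometric (u.c.p.) on `X`. -/
structure IsUCP {X : Type*} [UniformSpace X] (d : X → X → ℝ) : Prop where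
  nonneg : ∀ x y, 0 ≤ d x y
  self : ∀ x, d x x = 0
  symm : ∀ x y, d x y = d y x
  triangle : ∀ x y z, d x z ≤ d x y + d y z
  uniformContinuous : UniformContinuous (fun p : X × X => d p.1 p.2)

/-- `Lip d`, a subset of the product space `ℝ^X` (and, as a subtype, equipped with the topology of
pointwise convergence). -/
def Lip {X : Type*} (d : X → X → ℝ) : Set (X → ℝ) :=
  {f | (∀ x, |f x| ≤ 1) ∧ ∀ x x', |f x - f x'| ≤ d x x'}

theorem IsUCP.uniformContinuous_of_mem_Lip {X : Type*} [UniformSpace X] {d : X → X → ℝ}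
    (hd : IsUCP d) {f : X → ℝ} (hf : f ∈ Lip d) : UniformContinuous f := by
  refine Metric.uniformity_basis_dist.tendsto_right_iff.2 ?_
  intro ε hε
  have hU : {q : ℝ × ℝ | dist q.1 q.2 < ε} ∈ 𝓤 ℝ := Metric.dist_mem_uniformity hε
  have h := hd.uniformContinuous hU
  rw [mem_map, uniformity_prod_eq_comap_prod, mem_comap] at h
  obtain ⟨T, hT, hTs⟩ := h
  obtain ⟨V, hV, W, hW, hVW⟩ := mem_prod_iff.1 hT
  filter_upwards [hV] with z hz
  have h2 : dist (d z.1 z.2) (d z.2 z.2) < ε :=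
    @hTs ((z.1, z.2), (z.2, z.2)) (hVW ⟨hz, refl_mem_uniformity hW⟩)
  rw [hd.self, Real.dist_eq, sub_zero] at h2
  exact lt_of_le_of_lt (hf.2 z.1 z.2) (lt_of_le_of_lt (le_abs_self _) h2)

/-- For a u.c.p. `d`, the elements of `Lip d` are bounded uniformly continuous functions. -/
def IsUCP.lipToUb {X : Type*} [UniformSpace X] {d : X → X → ℝ} (hd : IsUCP d) (f : Lip d) :
    Ub X :=
  Ub.mk f.1 (hd.uniformContinuous_of_mem_Lip f.2) 1 f.2.1

/-- `μ` is a uniform measure: `μ` is continuous on `Lip d` (with its topology as a subset of the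
product space `ℝ^X`) for every u.c.p. `d` on `X`. -/
def IsUniformMeasure {X : Type*} [UniformSpace X] (μ : Meas X) : Prop :=
  ∀ (d : X → X → ℝ) (hd : IsUCP d), Continuous (fun f : Lip d => μ (hd.lipToUb f))

/-! ### The direct product -/

/-- The section `y ↦ f (x, y)` of `f ∈ Ub (X ∗ Y)`, as an element of `Ub Y`. -/
def sect {X : Type*} {Y : Type*} [UniformSpace X] [UniformSpace Y]
    (f : Ub (SemiuniformProd X Y)) (x : X) : Ub Y :=
  Ub.mk (fun y => f.1 ⟨x, y⟩) ((SemiuniformProd.uniformContinuous_iff.1 f.2).2 x) ‖f‖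
    (fun y => f.1.norm_coe_le_norm ⟨x, y⟩)

theorem norm_sect_le {X : Type*} {Y : Type*} [UniformSpace X] [UniformSpace Y]
    (f : Ub (SemiuniformProd X Y)) (x : X) : ‖sect f x‖ ≤ ‖f‖ :=
  (BoundedContinuousFunction.norm_le (norm_nonneg f)).2 fun y => f.1.norm_coe_le_norm ⟨x, y⟩

theorem abs_apply_sect_le {X : Type*} {Y : Type*} [UniformSpace X] [UniformSpace Y]
    (ν : Meas Y) (f : Ub (SemiuniformProd X Y)) (x : X) :
    |ν (sect f x)| ≤ ‖WeakDual.toStrongDual ν‖ * ‖f‖ :=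
  ((WeakDual.toStrongDual ν).le_opNorm _).trans
    (mul_le_mul_of_nonneg_left (norm_sect_le f x) (norm_nonneg _))

theorem uniformContinuous_apply_sect {X : Type*} {Y : Type*} [UniformSpace X] [UniformSpace Y]
    (ν : Meas Y) (f : Ub (SemiuniformProd X Y)) :
    UniformContinuous (fun x => ν (sect f x)) := by
  refine Metric.uniformity_basis_dist.tendsto_right_iff.2 ?_
  intro ε hε
  set C := ‖WeakDual.toStrongDual ν‖ with hC
  have hC0 : 0 ≤ C := norm_nonneg _
  have hδ : 0 < ε / (C + 1) := by positivity
  filter_upwards [(SemiuniformProd.uniformContinuous_iff.1 f.2).1 _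
    (Metric.dist_mem_uniformity hδ)] with z hz
  have h1 : ‖sect f z.1 - sect f z.2‖ ≤ ε / (C + 1) :=
    (BoundedContinuousFunction.norm_le hδ.le).2 fun y => (hz y).le
  have h2 : |ν (sect f z.1 - sect f z.2)| ≤ C * ‖sect f z.1 - sect f z.2‖ :=
    (WeakDual.toStrongDual ν).le_opNorm _
  change dist (ν (sect f z.1)) (ν (sect f z.2)) < ε
  rw [Real.dist_eq, ← map_sub]
  calc |ν (sect f z.1 - sect f z.2)| ≤ C * (ε / (C + 1)) :=
        h2.trans (mul_le_mul_of_nonneg_left h1 hC0)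
    _ < (C + 1) * (ε / (C + 1)) := mul_lt_mul_of_pos_right (lt_add_one C) hδ
    _ = ε := by field_simp

/-- The function `x ↦ ν (y ↦ f (x, y))`, as an element of `Ub X`. -/
def partialInt {X : Type*} {Y : Type*} [UniformSpace X] [UniformSpace Y] (ν : Meas Y)
    (f : Ub (SemiuniformProd X Y)) : Ub X :=
  Ub.mk (fun x => ν (sect f x)) (uniformContinuous_apply_sect ν f)
    (‖WeakDual.toStrongDual ν‖ * ‖f‖) (abs_apply_sect_le ν f)

/-- The direct product `μ ⊗ ν ∈ Meas (X ∗ Y)`: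
`(μ ⊗ ν) f = μ (x ↦ ν (y ↦ f (x, y)))`. -/
def directProd {X : Type*} {Y : Type*} [UniformSpace X] [UniformSpace Y] (μ : Meas X)
    (ν : Meas Y) : Meas (SemiuniformProd X Y) :=
  StrongDual.toWeakDual <|
    LinearMap.mkContinuous
      { toFun := fun f => μ (partialInt ν f)
        map_add' := fun f g => by
          rw [← map_add]
          congr 1
          refine Ub.ext fun x => ?_
          exact map_add ν (sect f x) (sect g x)
        map_smul' := fun c f => by
          rw [RingHom.id_apply, ← map_smul]
          congr 1
          refine Ub.ext fun x => ?_
          exact map_smul ν c (sect f x) }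
      (‖WeakDual.toStrongDual μ‖ * ‖WeakDual.toStrongDual ν‖)
      (fun f => by
        have h : ‖partialInt ν f‖ ≤ ‖WeakDual.toStrongDual ν‖ * ‖f‖ :=
          (BoundedContinuousFunction.norm_le (by positivity)).2 (abs_apply_sect_le ν f)
        rw [mul_assoc]
        exact ((WeakDual.toStrongDual μ).le_opNorm _).trans
          (mul_le_mul_of_nonneg_left h (norm_nonneg _)))

theorem directProd_apply {X : Type*} {Y : Type*} [UniformSpace X] [UniformSpace Y] (μ : Meas X)
    (ν : Meas Y) (f : Ub (SemiuniformProd X Y)) :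
    directProd μ ν f = μ (partialInt ν f) :=
  rfl

theorem directProd_mem_measPos {X : Type*} {Y : Type*} [UniformSpace X] [UniformSpace Y]
    {μ : Meas X} {ν : Meas Y} (hμ : μ ∈ MeasPos X) (hν : ν ∈ MeasPos Y) :
    directProd μ ν ∈ MeasPos (SemiuniformProd X Y) :=
  fun f hf => hμ (partialInt ν f) fun x => hν (sect f x) fun y => hf ⟨x, y⟩

/-- The direct product as a map `Meas⁺ X × Meas⁺ Y → Meas⁺ (X ∗ Y)`; the three sets carry the
subspace topologies of the weak* topologies. -/
def directProdPos {X : Type*} {Y : Type*} [UniformSpace X] [UniformSpace Y]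
    (p : MeasPos X × MeasPos Y) : MeasPos (SemiuniformProd X Y) :=
  ⟨directProd p.1.1 p.2.1, directProd_mem_measPos p.1.2 p.2.2⟩

end UnifMeas

end

namespace UnifMeas

/-! Fix `f` and set `d x x' = ‖sect f x - sect f x'‖`, a u.c.p. because the sections of `f` are
equicontinuous in `x`. Since `μ₀` is a uniform measure, it is almost concentrated near some finite
set `K`: it gives a small value to the `d`-distance to `K` truncated at 1
(`IsUniformMeasure.tendsto_truncDist`). This is one weak* condition, so it persists for `μ` near
`μ₀`.

For `ν` near `ν₀` the masses stay bounded and the integrals of the finitely many sections over `K`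
are close; hence the partial integrals of `f` for `ν` and `ν₀` differ by at most a small constant
plus a multiple of the truncated distance (`abs_partialInt_sub_le`). Integrating this bound against
the positive `μ` leaves only the weak* convergence of `μ` on the fixed function `partialInt ν₀ f`.
-/

/-- The constant function `1` as an element of `Ub X`. -/
def Ub.one (X : Type*) [UniformSpace X] : Ub X :=
  Ub.mk (fun _ => 1) uniformContinuous_const 1 (fun _ => by simp)

theorem Ub.abs_apply_le_norm {X : Type*} [UniformSpace X] (f : Ub X) (x : X) : |f.1 x| ≤ ‖f‖ :=
  f.1.norm_coe_le_norm x

theorem MeasPos.apply_mono {X : Type*} [UniformSpace X] {μ : Meas X} (hμ : μ ∈ MeasPos X)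
    {f g : Ub X} (h : ∀ x, f.1 x ≤ g.1 x) : μ f ≤ μ g := by
  have h1 : 0 ≤ μ (g - f) := hμ (g - f) fun x => sub_nonneg.2 (h x)
  rw [map_sub] at h1
  exact sub_nonneg.1 h1

theorem MeasPos.abs_apply_le {X : Type*} [UniformSpace X] {μ : Meas X} (hμ : μ ∈ MeasPos X)
    {f g : Ub X} (h : ∀ x, |f.1 x| ≤ g.1 x) : |μ f| ≤ μ g := by
  refine abs_le'.2 ⟨MeasPos.apply_mono hμ fun x => (le_abs_self _).trans (h x), ?_⟩
  rw [← map_neg]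
  exact MeasPos.apply_mono hμ fun x => (neg_le_abs _).trans (h x)

theorem MeasPos.apply_one_nonneg {X : Type*} [UniformSpace X] {μ : Meas X} (hμ : μ ∈ MeasPos X) :
    0 ≤ μ (Ub.one X) :=
  hμ _ fun _ => zero_le_one

theorem MeasPos.abs_apply_le_norm {X : Type*} [UniformSpace X] {μ : Meas X} (hμ : μ ∈ MeasPos X)
    (f : Ub X) : |μ f| ≤ μ (Ub.one X) * ‖f‖ := by
  have h := MeasPos.abs_apply_le hμ (f := f) (g := ‖f‖ • Ub.one X) fun x => by
    change |f.1 x| ≤ ‖f‖ * 1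
    rw [mul_one]
    exact Ub.abs_apply_le_norm f x
  rwa [map_smul, smul_eq_mul, mul_comm] at h

theorem tendsto_meas_iff {X : Type*} [UniformSpace X] {α : Type*} {l : Filter α}
    {u : α → Meas X} {μ : Meas X} :
    Tendsto u l (𝓝 μ) ↔ ∀ f : Ub X, Tendsto (fun a => u a f) l (𝓝 (μ f)) :=
  WeakBilin.tendsto_iff_forall_eval_tendsto _ ContinuousLinearMap.coe_injective

/-! ### Truncated distance to a finite set -/

/-- The distance to the finite set `K` with respect to `d`, truncated at `1`. -/
def truncDist {X : Type*} (d : X → X → ℝ) (K : Finset X) (x : X) : ℝ :=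
  K.fold min 1 (d x)

/-- Characterizes the minimum by its lower bounds; `K` may be empty, in which case the value is 1.
-/
theorem le_truncDist {X : Type*} {d : X → X → ℝ} {K : Finset X} {x : X} {c : ℝ} :
    c ≤ truncDist d K x ↔ c ≤ 1 ∧ ∀ k ∈ K, c ≤ d x k :=
  Finset.le_fold_min _

theorem IsUCP.truncDist_nonneg {X : Type*} [UniformSpace X] {d : X → X → ℝ} (hd : IsUCP d)
    (K : Finset X) (x : X) : 0 ≤ truncDist d K x :=
  le_truncDist.2 ⟨zero_le_one, fun k _ => hd.nonneg x k⟩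

theorem IsUCP.truncDist_eq_zero {X : Type*} [UniformSpace X] {d : X → X → ℝ} (hd : IsUCP d)
    {K : Finset X} {x : X} (hx : x ∈ K) : truncDist d K x = 0 :=
  le_antisymm (((le_truncDist.1 le_rfl).2 x hx).trans_eq (hd.self x)) (hd.truncDist_nonneg K x)

theorem IsUCP.truncDist_mem_Lip {X : Type*} [UniformSpace X] {d : X → X → ℝ} (hd : IsUCP d)
    (K : Finset X) : truncDist d K ∈ Lip d := by
  have key : ∀ x x', truncDist d K x - d x x' ≤ truncDist d K x' := fun x x' => by
    obtain ⟨h1, h2⟩ := le_truncDist.1 (le_refl (truncDist d K x))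
    refine le_truncDist.2 ⟨by linarith [hd.nonneg x x'], fun k hk => ?_⟩
    linarith [h2 k hk, hd.triangle x x' k]
  refine ⟨fun x => ?_, fun x x' => abs_le'.2 ⟨?_, ?_⟩⟩
  · rw [abs_of_nonneg (hd.truncDist_nonneg K x)]
    exact (le_truncDist.1 le_rfl).1
  · linarith [key x x']
  · linarith [key x' x, hd.symm x x']

/-- The truncated distance to a finite set as an element of `Lip d`. -/
def IsUCP.lipTruncDist {X : Type*} [UniformSpace X] {d : X → X → ℝ} (hd : IsUCP d)
    (K : Finset X) : Lip d :=
  ⟨truncDist d K, hd.truncDist_mem_Lip K⟩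

/-- A uniform measure is concentrated near finite sets, for every u.c.p. -/
theorem IsUniformMeasure.tendsto_truncDist {X : Type*} [UniformSpace X] {μ : Meas X}
    (hμ : IsUniformMeasure μ) {d : X → X → ℝ} (hd : IsUCP d) :
    Tendsto (fun K : Finset X => μ (hd.lipToUb (hd.lipTruncDist K))) atTop (𝓝 0) := by
  have h0 : (0 : X → ℝ) ∈ Lip d :=
    ⟨fun x => by simp, fun x x' => by simpa using hd.nonneg x x'⟩
  have hlim : Tendsto hd.lipTruncDist atTop (𝓝 (⟨0, h0⟩ : Lip d)) := by
    refine tendsto_subtype_rng.2 (tendsto_pi_nhds.2 fun x => ?_)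
    refine tendsto_const_nhds.congr' ?_
    -- Pointwise convergence to 0 is immediate: the value at `x` vanishes once `x ∈ K`.
    filter_upwards [eventually_ge_atTop {x}] with K hK
    exact (hd.truncDist_eq_zero (hK (Finset.mem_singleton_self x))).symm
  have hz : hd.lipToUb ⟨0, h0⟩ = 0 := Ub.ext fun _ => rfl
  have h := ((hμ d hd).tendsto ⟨0, h0⟩).comp hlim
  rwa [hz, map_zero] at h

/-! ### The pseudometric of a function on the semiuniform product -/

section Section

variable {X : Type*} {Y : Type*} [UniformSpace X] [UniformSpace Y]

/-- Equicontinuity uniform in `y` is exactly uniform continuity for the sup norm on `Ub Y`. -/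
theorem uniformContinuous_sect (f : Ub (SemiuniformProd X Y)) : UniformContinuous (sect f) := by
  refine Metric.uniformity_basis_dist_le.tendsto_right_iff.2 fun ε hε => ?_
  filter_upwards [(SemiuniformProd.uniformContinuous_iff.1 f.2).1 _
    (Metric.dist_mem_uniformity hε)] with z hz
  rw [dist_eq_norm]
  exact (BoundedContinuousFunction.norm_le hε.le).2 fun y => (hz y).le

theorem isUCP_dist_sect (f : Ub (SemiuniformProd X Y)) :
    IsUCP (fun x x' => dist (sect f x) (sect f x')) where
  nonneg _ _ := dist_nonneg
  self _ := dist_self _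
  symm _ _ := dist_comm _ _
  triangle _ _ _ := dist_triangle _ _ _
  uniformContinuous := ((uniformContinuous_sect f).comp uniformContinuous_fst).dist
    ((uniformContinuous_sect f).comp uniformContinuous_snd)

/-- If the sections of `f` at the points of `K` have nearly the same integrals for `ν` and `ν'`,
then `partialInt ν f - partialInt ν' f` is dominated by the truncated distance to `K`. -/
theorem abs_partialInt_sub_le {f : Ub (SemiuniformProd X Y)} {ν ν' : Meas Y}
    (hν : ν ∈ MeasPos Y) (hν' : ν' ∈ MeasPos Y) {C : ℝ} (hC : 0 < C)
    (hνC : ν (Ub.one Y) ≤ C) (hνC' : ν' (Ub.one Y) ≤ C) {K : Finset X} {δ : ℝ} (hδ : 0 ≤ δ)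
    (hK : ∀ k ∈ K, |ν (sect f k) - ν' (sect f k)| ≤ δ) (x : X) :
    |ν (sect f x) - ν' (sect f x)| ≤
      δ + 2 * C * (1 + ‖f‖) * truncDist (fun x x' => dist (sect f x) (sect f x')) K x := by
  have hf : 0 ≤ ‖f‖ := norm_nonneg f
  have bound : ∀ g : Ub Y, |ν g - ν' g| ≤ 2 * C * ‖g‖ := fun g => by
    have h1 := (MeasPos.abs_apply_le_norm hν g).trans
      (mul_le_mul_of_nonneg_right hνC (norm_nonneg g))
    have h2 := (MeasPos.abs_apply_le_norm hν' g).trans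
      (mul_le_mul_of_nonneg_right hνC' (norm_nonneg g))
    linarith [abs_sub (ν g) (ν' g)]
  -- The summand `‖f‖` handles truncation at 1, and the summand 1 handles the distances to points of
  -- `K`.
  have hA : 0 < 2 * C * (1 + ‖f‖) := by positivity
  rw [← sub_le_iff_le_add', ← div_le_iff₀' hA]
  refine le_truncDist.2 ⟨?_, fun k hk => ?_⟩
  · rw [div_le_one hA]
    have h1 : 2 * C * ‖sect f x‖ ≤ 2 * C * (1 + ‖f‖) := by
      gcongr
      linarith [norm_sect_le f x]
    linarith [bound (sect f x)]
  · rw [div_le_iff₀' hA, dist_eq_norm]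
    have h1 := bound (sect f x - sect f k)
    have h2 : 2 * C * ‖sect f x - sect f k‖ ≤ 2 * C * (1 + ‖f‖) * ‖sect f x - sect f k‖ :=
      mul_le_mul_of_nonneg_right
        (le_mul_of_one_le_right (by positivity) (le_add_of_nonneg_right hf)) (norm_nonneg _)
    have h3 := abs_add_le (ν (sect f x - sect f k) - ν' (sect f x - sect f k))
      (ν (sect f k) - ν' (sect f k))
    have h4 : ν (sect f x - sect f k) - ν' (sect f x - sect f k) +
        (ν (sect f k) - ν' (sect f k)) = ν (sect f x) - ν' (sect f x) := by
      rw [map_sub, map_sub]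
      ring
    rw [h4] at h3
    linarith [hK k hk]

/-! ### Joint continuity, tested on one function at a time -/

theorem tendsto_directProd_apply {μ₀ : MeasPos X} (hμ₀ : IsUniformMeasure (μ₀ : Meas X))
    (ν₀ : MeasPos Y) (f : Ub (SemiuniformProd X Y)) :
    Tendsto (fun p : MeasPos X × MeasPos Y => directProd p.1.1 p.2.1 f) (𝓝 (μ₀, ν₀))
      (𝓝 (directProd μ₀.1 ν₀.1 f)) := by
  have evalX : ∀ g : Ub X, Tendsto (fun p : MeasPos X × MeasPos Y => p.1.1 g) (𝓝 (μ₀, ν₀))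
      (𝓝 (μ₀.1 g)) := tendsto_meas_iff.1 (by fun_prop : Continuous
        fun p : MeasPos X × MeasPos Y => p.1.1).continuousAt
  have evalY : ∀ g : Ub Y, Tendsto (fun p : MeasPos X × MeasPos Y => p.2.1 g) (𝓝 (μ₀, ν₀))
      (𝓝 (ν₀.1 g)) := tendsto_meas_iff.1 (by fun_prop : Continuous
        fun p : MeasPos X × MeasPos Y => p.2.1).continuousAt
  refine Metric.tendsto_nhds.2 fun ε hε => ?_
  have hd := isUCP_dist_sect f
  -- The added 1 leaves room for nearby masses and keeps the constants positive.
  set C := ν₀.1 (Ub.one Y) + 1 with hC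
  set m := μ₀.1 (Ub.one X) + 1 with hm
  have hC0 : 0 < C := by linarith [MeasPos.apply_one_nonneg ν₀.2]
  have hm0 : 0 < m := by linarith [MeasPos.apply_one_nonneg μ₀.2]
  have hf : 0 ≤ ‖f‖ := norm_nonneg f
  set A := 2 * C * (1 + ‖f‖) with hA
  have hA0 : 0 < A := by positivity
  -- Chosen so that `δ * m = ε / 4`; two more errors of `ε / 4` give a total below `ε`.
  set δ := ε / (4 * m) with hδ
  have hδ0 : 0 < δ := by positivity
  obtain ⟨K, hK⟩ := ((hμ₀.tendsto_truncDist hd).eventually_lt_const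
    (show 0 < ε / (4 * A) by positivity)).exists
  set w := hd.lipToUb (hd.lipTruncDist K) with hw
  have hKν : ∀ᶠ p : MeasPos X × MeasPos Y in 𝓝 (μ₀, ν₀), ∀ k ∈ K,
      |p.2.1 (sect f k) - ν₀.1 (sect f k)| < δ :=
    (Filter.eventually_all_finset K).2 fun k _ => Metric.tendsto_nhds.1 (evalY (sect f k)) δ hδ0
  filter_upwards [hKν, (evalX w).eventually_lt_const hK,
    (evalX (Ub.one X)).eventually_lt_const (lt_add_one _),
    (evalY (Ub.one Y)).eventually_lt_const (lt_add_one _),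
    Metric.tendsto_nhds.1 (evalX (partialInt ν₀.1 f)) (ε / 4) (by positivity)]
    with p hp1 hp2 hp3 hp4 hp5
  rw [Real.dist_eq] at hp5 ⊢
  rw [directProd_apply, directProd_apply]
  have h1 : |p.1.1 (partialInt p.2.1 f - partialInt ν₀.1 f)| ≤
      p.1.1 (δ • Ub.one X + A • w) := by
    refine MeasPos.abs_apply_le p.1.2 fun x => ?_
    change |p.2.1 (sect f x) - ν₀.1 (sect f x)| ≤
      δ * 1 + A * truncDist (fun x x' => dist (sect f x) (sect f x')) K x
    rw [mul_one]
    exact abs_partialInt_sub_le p.2.2 ν₀.2 hC0 hp4.le (by linarith) hδ0.le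
      (fun k hk => (hp1 k hk).le) x
  rw [map_sub, map_add, map_smul, map_smul, smul_eq_mul, smul_eq_mul] at h1
  have h2 : δ * p.1.1 (Ub.one X) ≤ ε / 4 := by
    calc δ * p.1.1 (Ub.one X) ≤ δ * m := by gcongr
      _ = ε / 4 := by rw [hδ]; field_simp
  have h3 : A * p.1.1 w ≤ ε / 4 := by
    calc A * p.1.1 w ≤ A * (ε / (4 * A)) := by gcongr
      _ = ε / 4 := by field_simp
  -- The intermediate term changes `ν` to `ν₀` first, while `μ` is still varying.
  have h4 := abs_sub_le (p.1.1 (partialInt p.2.1 f)) (p.1.1 (partialInt ν₀.1 f))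
    (μ₀.1 (partialInt ν₀.1 f))
  linarith

end Section

end UnifMeas

theorem mainTheorem4 {X : Type*} {Y : Type*} [UniformSpace X] [UniformSpace Y]
    [T2Space X] [T2Space Y]
    (μ₀ : UnifMeas.MeasPos X) (hμ₀ : UnifMeas.IsUniformMeasure (μ₀ : UnifMeas.Meas X))
    (ν₀ : UnifMeas.MeasPos Y) :
    ContinuousAt
      (UnifMeas.directProdPos :
        UnifMeas.MeasPos X × UnifMeas.MeasPos Y →
          UnifMeas.MeasPos (UnifMeas.SemiuniformProd X Y))
      (μ₀, ν₀) :=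
  tendsto_subtype_rng.2 <| UnifMeas.tendsto_meas_iff.2 <|
    UnifMeas.tendsto_directProd_apply hμ₀ ν₀
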